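/- Let $A$ be a unital C*-algebra, let $\mathcal{C}(A)$ be the poset of its unital commutative C*-subalgebras ordered by inclusion, and let $\mathcal{T}(A)=\mathbf{Sets}^{\mathcal{C}(A)}$ be the topos of functors $\mathcal{C}(A)\to\mathbf{Sets}$. Let $\underline{A}$ be the tautological functor $C\mapsto C$, whose self-adjoint part $\underline{A}_{\mathrm{sa}}\colon C\mapsto C_{\mathrm{sa}}$ is an internal commutative ring in $\mathcal{T}(A)$ under the stagewise operations. For a commutative ring $R$ (in $\mathbf{Sets}$, or internal to a topos), consider the spectrum relations on symbols $\mathsf{D}_a$, $a\in R$: $$\mathsf{D}_1=\top,\quad \mathsf{D}_a\wedge \mathsf{D}_{-a}=\bot,\quad \mathsf{D}_{-b^2}=\bot,\quad \mathsf{D}_{a+b}\le \mathsf{D}_a\vee \mathsf{D}_b,\quad \mathsf{D}_{ab}=(\mathsf{D}_a\wedge \mathsf{D}_b)\vee(\mathsf{D}_{-a}\wedge \mathsf{D}_{-b}).$$ For $C\in\mathcal{C}(A)$ let $L_C$ be the distributive lattice (with $\top$ and $\bot$) in $\mathbf{Sets}$ freely generated by the symbols $D_c$, $c\in C_{\mathrm{sa}}$,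 subject to these relations. Let $\underline{L}_{\underline{A}}$ be the internal distributive lattice in $\mathcal{T}(A)$ freely generated by the symbols $\mathsf{D}_a$, with $a$ of type $\underline{A}_{\mathrm{sa}}$, subject to these relations interpreted in $\mathcal{T}(A)$; that is, $\underline{L}_{\underline{A}}$ with its morphism $\underline{A}_{\mathrm{sa}}\to\underline{L}_{\underline{A}}$, $a\mapsto \mathsf{D}_a$, is initial among internal distributive lattices in $\mathcal{T}(A)$ equipped with a morphism from $\underline{A}_{\mathrm{sa}}$ satisfying the relations. Then $\underline{L}_{\underline{A}}$ exists and is computed locally. 1. The functor $C\mapsto L_C$, with transition maps $D_c\mapsto D_c$, with the stagewise lattice operations and with $c\mapsto D_c$ as generating morphism, is such an internal lattice. For any $\underline{L}_{\underline{A}}$ as above there are lattice isomorphisms $L_C\cong\underline{L}_{\underline{A}}(C)$ for all $C\in\mathcal{C}(A)$, which carry $D_c$ to the value at $c$ of the generating morphism. 2. If $C\subseteq D$, then under these isomorphisms the map $\underline{L}_{\underline{A}}(C)\to\underline{L}_{\underline{A}}(D)$ given by functoriality is the lattice homomorphism $L_C\to L_D$ that sends each generator $D_c$, $c\in C_{\mathrm{sa}}$,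 to the generator $D_c$ of $L_D$. This homomorphism is injective. 3. Let $C^+$ be the set of positive elements of $C$; write $p\preccurlyeq q$ iff $p\le nq$ for some $n\in\mathbb{N}$, and $p\approx q$ iff $p\preccurlyeq q$ and $q\preccurlyeq p$. Any two elements of $C^+$ have a supremum and an infimum in $C^+$, and these descend to $C^+/\approx$ and make it a lattice, whose order is induced by $\preccurlyeq$. There are lattice isomorphisms $L_C\cong C^+/\approx$ for all $C\in\mathcal{C}(A)$, compatible with the maps $L_C\to L_D$ and $C^+/\approx\,\to D^+/\approx$ for $C\subseteq D$. -/

import Mathlib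

open CategoryTheory MonoidalCategory CartesianMonoidalCategory

universe u v w

/-! ## The distributive lattice of a commutative ring in `Sets` -/

namespace SpectralLattice

/-- Formal lattice expressions over a set of generating symbols. -/
inductive Term (X : Type u) : Type u
  | gen (a : X) : Term X
  | top : Term X
  | bot : Term X
  | inf (s t : Term X) : Term X
  | sup (s t : Term X) : Term X

/-- The congruence on lattice expressions in the symbols `D_a` (`a : R`) generated by the axioms of
bounded distributive lattices and the five spectrum relations
`D_1 = ⊤`, `D_a ⊓ D_{-a} = ⊥`, `D_{-b²} = ⊥`, `D_{a+b} ≤ D_a ⊔ D_b` and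
`D_{ab} = (D_a ⊓ D_b) ⊔ (D_{-a} ⊓ D_{-b})`, where `x ≤ y` is written as `x ⊔ y = y`. -/
inductive Rel (R : Type u) [CommRing R] : Term R → Term R → Prop
  | refl (s) : Rel R s s
  | symm {s t} : Rel R s t → Rel R t s
  | trans {s t r} : Rel R s t → Rel R t r → Rel R s r
  | inf_congr {s s' t t'} : Rel R s s' → Rel R t t' → Rel R (.inf s t) (.inf s' t')
  | sup_congr {s s' t t'} : Rel R s s' → Rel R t t' → Rel R (.sup s t) (.sup s' t')
  | inf_comm (s t) : Rel R (.inf s t) (.inf t s)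
  | sup_comm (s t) : Rel R (.sup s t) (.sup t s)
  | inf_assoc (s t r) : Rel R (.inf (.inf s t) r) (.inf s (.inf t r))
  | sup_assoc (s t r) : Rel R (.sup (.sup s t) r) (.sup s (.sup t r))
  | inf_sup_self (s t) : Rel R (.inf s (.sup s t)) s
  | sup_inf_self (s t) : Rel R (.sup s (.inf s t)) s
  | inf_sup_distrib (s t r) : Rel R (.inf s (.sup t r)) (.sup (.inf s t) (.inf s r))
  | inf_top (s) : Rel R (.inf s .top) s
  | sup_bot (s) : Rel R (.sup s .bot) s
  | one : Rel R (.gen 1) .top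
  | inf_neg (a : R) : Rel R (.inf (.gen a) (.gen (-a))) .bot
  | neg_sq (b : R) : Rel R (.gen (-(b * b))) .bot
  | add (a b : R) :
      Rel R (.sup (.gen (a + b)) (.sup (.gen a) (.gen b))) (.sup (.gen a) (.gen b))
  | mul (a b : R) :
      Rel R (.gen (a * b))
        (.sup (.inf (.gen a) (.gen b)) (.inf (.gen (-a)) (.gen (-b))))

/-- The congruence `Rel` as a setoid. -/
def relSetoid (R : Type u) [CommRing R] : Setoid (Term R) where
  r := Rel R
  iseqv := ⟨Rel.refl, Rel.symm, Rel.trans⟩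

end SpectralLattice

open SpectralLattice in
/-- The distributive lattice freely generated (in `Sets`) by symbols `D_a`, `a : R`, subject to the
five spectrum relations. For `R = C_sa` this is the lattice `L_C`. -/
def SpectralLattice (R : Type u) [CommRing R] : Type u :=
  Quotient (relSetoid R)

namespace SpectralLattice

variable {R : Type u} [CommRing R]

/-- The generator `D_a`. -/
def D (a : R) : SpectralLattice R := Quotient.mk (relSetoid R) (.gen a)

/-- The lattice structure, with the operations induced by the formal ones. -/
instance : Lattice (SpectralLattice R) :=
  letI : Max (SpectralLattice R) :=
    ⟨Quotient.map₂ Term.sup fun _ _ h _ _ h' => Rel.sup_congr h h'⟩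
  letI : Min (SpectralLattice R) :=
    ⟨Quotient.map₂ Term.inf fun _ _ h _ _ h' => Rel.inf_congr h h'⟩
  Lattice.mk'
    (by rintro ⟨s⟩ ⟨t⟩; exact Quotient.sound (Rel.sup_comm s t))
    (by rintro ⟨s⟩ ⟨t⟩ ⟨r⟩; exact Quotient.sound (Rel.sup_assoc s t r))
    (by rintro ⟨s⟩ ⟨t⟩; exact Quotient.sound (Rel.inf_comm s t))
    (by rintro ⟨s⟩ ⟨t⟩ ⟨r⟩; exact Quotient.sound (Rel.inf_assoc s t r))
    (by rintro ⟨s⟩ ⟨t⟩; exact Quotient.sound (Rel.sup_inf_self s t))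
    (by rintro ⟨s⟩ ⟨t⟩; exact Quotient.sound (Rel.inf_sup_self s t))

instance : DistribLattice (SpectralLattice R) :=
  DistribLattice.ofInfSupLe (by
    rintro ⟨s⟩ ⟨t⟩ ⟨r⟩
    exact le_of_eq (Quotient.sound (Rel.inf_sup_distrib s t r)))

instance : BoundedOrder (SpectralLattice R) where
  top := Quotient.mk (relSetoid R) .top
  bot := Quotient.mk (relSetoid R) .bot
  le_top := by
    rintro ⟨s⟩
    exact inf_eq_left.mp (Quotient.sound (Rel.inf_top s))
  bot_le := by
    rintro ⟨s⟩
    exact sup_eq_left.mp (Quotient.sound (Rel.sup_bot s))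

/-- A map from `R` to a bounded distributive lattice satisfies the five spectrum relations. -/
structure Satisfies {M : Type v} [DistribLattice M] [BoundedOrder M] (f : R → M) : Prop where
  one : f 1 = ⊤
  inf_neg (a : R) : f a ⊓ f (-a) = ⊥
  neg_sq (b : R) : f (-(b * b)) = ⊥
  add (a b : R) : f (a + b) ≤ f a ⊔ f b
  mul (a b : R) : f (a * b) = (f a ⊓ f b) ⊔ (f (-a) ⊓ f (-b))

theorem satisfies_D : Satisfies (D : R → SpectralLattice R) where
  one := Quotient.sound Rel.one
  inf_neg a := Quotient.sound (Rel.inf_neg a)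
  neg_sq b := Quotient.sound (Rel.neg_sq b)
  add a b := sup_eq_right.mp (Quotient.sound (Rel.add a b))
  mul a b := Quotient.sound (Rel.mul a b)

/-- Evaluation of a lattice expression. -/
def Term.eval {X : Type u} {M : Type v} [DistribLattice M] [BoundedOrder M] (f : X → M) :
    Term X → M
  | .gen a => f a
  | .top => ⊤
  | .bot => ⊥
  | .inf s t => s.eval f ⊓ t.eval f
  | .sup s t => s.eval f ⊔ t.eval f

theorem Satisfies.eval_eq {M : Type v} [DistribLattice M] [BoundedOrder M] {f : R → M}
    (hf : Satisfies f) {s t : Term R} (h : Rel R s t) : s.eval f = t.eval f := by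
  induction h with
  | refl s => rfl
  | symm _ ih => exact ih.symm
  | trans _ _ ih ih' => exact ih.trans ih'
  | inf_congr _ _ ih ih' => simp only [Term.eval, ih, ih']
  | sup_congr _ _ ih ih' => simp only [Term.eval, ih, ih']
  | inf_comm s t => exact _root_.inf_comm _ _
  | sup_comm s t => exact _root_.sup_comm _ _
  | inf_assoc s t r => exact _root_.inf_assoc _ _ _
  | sup_assoc s t r => exact _root_.sup_assoc _ _ _
  | inf_sup_self s t => exact _root_.inf_sup_self
  | sup_inf_self s t => exact _root_.sup_inf_self
  | inf_sup_distrib s t r => exact inf_sup_left _ _ _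
  | inf_top s => exact inf_top_eq _
  | sup_bot s => exact sup_bot_eq _
  | one => exact hf.one
  | inf_neg a => exact hf.inf_neg a
  | neg_sq b => exact hf.neg_sq b
  | add a b => exact sup_eq_right.mpr (hf.add a b)
  | mul a b => exact hf.mul a b

/-- The homomorphism out of the lattice determined by a map on generators that satisfies the
spectrum relations. -/
def lift {M : Type v} [DistribLattice M] [BoundedOrder M] (f : R → M) (hf : Satisfies f) :
    BoundedLatticeHom (SpectralLattice R) M where
  toFun := Quotient.lift (Term.eval f) fun _ _ h => hf.eval_eq h
  map_sup' := by rintro ⟨s⟩ ⟨t⟩; rfl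
  map_inf' := by rintro ⟨s⟩ ⟨t⟩; rfl
  map_top' := rfl
  map_bot' := rfl

/-- The homomorphism induced by a ring homomorphism: it sends the generator `D_a` to the
generator `D_{f a}`. -/
def map {S : Type v} [CommRing S] (f : R →+* S) :
    BoundedLatticeHom (SpectralLattice R) (SpectralLattice S) :=
  lift (fun a => D (f a))
    { one := by rw [map_one]; exact satisfies_D.one
      inf_neg := fun a => by rw [map_neg]; exact satisfies_D.inf_neg _
      neg_sq := fun b => by rw [map_neg, map_mul]; exact satisfies_D.neg_sq _
      add := fun a b => by rw [map_add]; exact satisfies_D.add _ _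
      mul := fun a b => by rw [map_mul, map_neg, map_neg]; exact satisfies_D.mul _ _ }

@[simp]
theorem map_D {S : Type v} [CommRing S] (f : R →+* S) (a : R) : map f (D a) = D (f a) := rfl

/-- A homomorphism out of the lattice is determined by its values on the generators. -/
theorem hom_ext {M : Type v} [DistribLattice M] [BoundedOrder M]
    {g g' : BoundedLatticeHom (SpectralLattice R) M} (h : ∀ a, g (D a) = g' (D a)) : g = g' := by
  ext x
  induction x using Quotient.inductionOn with | _ s
  induction s with
  | gen a => exact h a
  | top => exact (map_top g).trans (map_top g').symm
  | bot => exact (map_bot g).trans (map_bot g').symm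
  | inf s t hs ht =>
    exact (map_inf g _ _).trans
      ((congrArg₂ (fun x y : M => x ⊓ y) hs ht).trans (map_inf g' _ _).symm)
  | sup s t hs ht =>
    exact (map_sup g _ _).trans
      ((congrArg₂ (fun x y : M => x ⊔ y) hs ht).trans (map_sup g' _ _).symm)

variable (R) in
theorem map_id : map (RingHom.id R) = BoundedLatticeHom.id (SpectralLattice R) :=
  hom_ext fun _ => rfl

theorem map_comp {S : Type v} [CommRing S] {T : Type w} [CommRing T]
    (f : R →+* S) (g : S →+* T) :
    map (g.comp f) = (map g).comp (map f) :=
  hom_ext fun _ => rfl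

end SpectralLattice

/-! ## Positive elements of a C⋆-algebra modulo `≈` -/

/-- The positive elements of a C⋆-algebra: those of the form `c⋆ c`. -/
def PosElem (B : Type u) [CStarAlgebra B] : Type u := {p : B // ∃ c : B, p = star c * c}

namespace PosElem

variable {B : Type u} [CStarAlgebra B]

theorem le_aux (a b : B) :
    (∃ c : B, b - a = star c * c) ↔ (CStarAlgebra.spectralOrder B).le a b := by
  let _ := CStarAlgebra.spectralOrder B
  have := CStarAlgebra.spectralOrderedRing B
  change _ ↔ a ≤ b
  rw [← CStarAlgebra.nonneg_iff_eq_star_mul_self, sub_nonneg]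

/-- The usual order: `p ≤ q` iff `q - p = c⋆ c` for some `c` in the algebra. -/
instance : PartialOrder (PosElem B) where
  le p q := ∃ c : B, q.1 - p.1 = star c * c
  le_refl p := (le_aux _ _).2 ((CStarAlgebra.spectralOrder B).le_refl _)
  le_trans p q r h h' :=
    (le_aux _ _).2 ((CStarAlgebra.spectralOrder B).le_trans _ _ _ ((le_aux _ _).1 h)
      ((le_aux _ _).1 h'))
  le_antisymm p q h h' := Subtype.ext
    ((CStarAlgebra.spectralOrder B).le_antisymm _ _ ((le_aux _ _).1 h) ((le_aux _ _).1 h'))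

theorem nsmul_aux (n : ℕ) {a b : B} (h : ∃ c : B, b - a = star c * c) :
    ∃ c : B, n • b - n • a = star c * c := by
  let _ := CStarAlgebra.spectralOrder B
  have := CStarAlgebra.spectralOrderedRing B
  exact (le_aux _ _).2 (nsmul_le_nsmul_right ((le_aux _ _).1 h : a ≤ b) n)

instance : SMul ℕ (PosElem B) :=
  ⟨fun n p => ⟨n • p.1, by
    obtain ⟨c, hc⟩ := nsmul_aux n (a := 0) (b := p.1) (by simpa using p.2)
    exact ⟨c, by simpa using hc⟩⟩⟩

/-- `p ≼ q` iff `p ≤ n q` for some natural number `n`. -/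
def Dominated (p q : PosElem B) : Prop := ∃ n : ℕ, p ≤ n • q

theorem Dominated.refl (p : PosElem B) : Dominated p p :=
  ⟨1, le_of_eq (Subtype.ext (one_nsmul p.1).symm)⟩

theorem Dominated.trans {p q r : PosElem B} (h : Dominated p q) (h' : Dominated q r) :
    Dominated p r := by
  obtain ⟨n, hn⟩ := h
  obtain ⟨m, hm⟩ := h'
  refine ⟨n * m, hn.trans ?_⟩
  have h : n • q ≤ n • (m • r) := nsmul_aux n hm
  have e : n • (m • r) = (n * m) • r := Subtype.ext (mul_nsmul' r.1 n m).symm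
  exact h.trans (le_of_eq e)

variable (B) in
/-- `p ≈ q` iff `p ≼ q` and `q ≼ p`. -/
def approxSetoid : Setoid (PosElem B) where
  r p q := Dominated p q ∧ Dominated q p
  iseqv := ⟨fun p => ⟨.refl p, .refl p⟩, fun h => ⟨h.2, h.1⟩,
    fun h h' => ⟨h.1.trans h'.1, h'.2.trans h.2⟩⟩

/-- A unital star homomorphism maps positive elements to positive elements. -/
def map {B' : Type v} [CStarAlgebra B'] (f : B →⋆ₐ[ℂ] B') (p : PosElem B) : PosElem B' :=
  ⟨f p.1, by
    obtain ⟨c, hc⟩ := p.2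
    exact ⟨f c, by rw [hc, map_mul, map_star]⟩⟩

theorem Dominated.map {B' : Type v} [CStarAlgebra B'] (f : B →⋆ₐ[ℂ] B') {p q : PosElem B}
    (h : Dominated p q) : Dominated (p.map f) (q.map f) := by
  obtain ⟨n, c, hc⟩ := h
  refine ⟨n, f c, ?_⟩
  have h := congrArg f hc
  rw [map_sub, map_mul, map_star] at h
  rw [← h]
  exact congrArg (· - f p.1) (map_nsmul f n q.1).symm

end PosElem

/-- The quotient `B⁺/≈`. -/
def PosQuot (B : Type u) [CStarAlgebra B] : Type u := Quotient (PosElem.approxSetoid B)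

namespace PosQuot

variable {B : Type u} [CStarAlgebra B]

/-- The class `[p]` in `B⁺/≈`. -/
def mk (p : PosElem B) : PosQuot B := Quotient.mk (PosElem.approxSetoid B) p

/-- The order on `B⁺/≈`: `[p] ≤ [q]` iff `p ≼ q`. -/
instance : PartialOrder (PosQuot B) where
  le := Quotient.lift₂ PosElem.Dominated fun _ _ _ _ h h' =>
    propext ⟨fun k => (h.2.trans k).trans h'.1, fun k => (h.1.trans k).trans h'.2⟩
  le_refl := by rintro ⟨p⟩; exact PosElem.Dominated.refl p
  le_trans := by rintro ⟨p⟩ ⟨q⟩ ⟨r⟩ h h'; exact PosElem.Dominated.trans h h'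
  le_antisymm := by rintro ⟨p⟩ ⟨q⟩ h h'; exact Quotient.sound ⟨h, h'⟩

/-- The map `[p] ↦ [f p]` induced by a unital star homomorphism. -/
def map {B' : Type v} [CStarAlgebra B'] (f : B →⋆ₐ[ℂ] B') : PosQuot B → PosQuot B' :=
  Quotient.map (PosElem.map f) fun _ _ h => ⟨h.1.map f, h.2.map f⟩

end PosQuot

/-! ## Internal distributive lattices presented by the spectrum relations -/

section Internal

variable {𝓔 : Type u} [Category.{v} 𝓔] [CartesianMonoidalCategory 𝓔]

/-- An internal (bounded) distributive lattice structure on an object `L` of a category with finite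
products. The equations are interpreted on generalized elements `x : T ⟶ L`, which by the Yoneda
lemma is the same as the commutativity of the usual diagrams. -/
structure InternalDistribLattice (L : 𝓔) where
  top : 𝟙_ 𝓔 ⟶ L
  bot : 𝟙_ 𝓔 ⟶ L
  inf : L ⊗ L ⟶ L
  sup : L ⊗ L ⟶ L
  inf_comm {T : 𝓔} (x y : T ⟶ L) : lift x y ≫ inf = lift y x ≫ inf
  sup_comm {T : 𝓔} (x y : T ⟶ L) : lift x y ≫ sup = lift y x ≫ sup
  inf_assoc {T : 𝓔} (x y z : T ⟶ L) :
    lift (lift x y ≫ inf) z ≫ inf = lift x (lift y z ≫ inf) ≫ inf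
  sup_assoc {T : 𝓔} (x y z : T ⟶ L) :
    lift (lift x y ≫ sup) z ≫ sup = lift x (lift y z ≫ sup) ≫ sup
  inf_sup_self {T : 𝓔} (x y : T ⟶ L) : lift x (lift x y ≫ sup) ≫ inf = x
  sup_inf_self {T : 𝓔} (x y : T ⟶ L) : lift x (lift x y ≫ inf) ≫ sup = x
  inf_sup_distrib {T : 𝓔} (x y z : T ⟶ L) :
    lift x (lift y z ≫ sup) ≫ inf = lift (lift x y ≫ inf) (lift x z ≫ inf) ≫ sup
  inf_top {T : 𝓔} (x : T ⟶ L) : lift x (toUnit T ≫ top) ≫ inf = x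
  sup_bot {T : 𝓔} (x : T ⟶ L) : lift x (toUnit T ≫ bot) ≫ sup = x

namespace InternalDistribLattice

/-- A morphism of `𝓔` is an internal homomorphism of bounded lattices. -/
structure IsHom {L M : 𝓔} (hL : InternalDistribLattice L) (hM : InternalDistribLattice M)
    (g : L ⟶ M) : Prop where
  top : hL.top ≫ g = hM.top
  bot : hL.bot ≫ g = hM.bot
  inf {T : 𝓔} (x y : T ⟶ L) : (lift x y ≫ hL.inf) ≫ g = lift (x ≫ g) (y ≫ g) ≫ hM.inf
  sup {T : 𝓔} (x y : T ⟶ L) : (lift x y ≫ hL.sup) ≫ g = lift (x ≫ g) (y ≫ g) ≫ hM.sup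

variable [BraidedCategory 𝓔]

open scoped CommRingObj MonObj in
/-- A morphism `d : R ⟶ L`, `a ↦ D_a`, from an internal commutative ring to an internal
distributive lattice satisfies the five spectrum relations in the internal language. The
generalized elements `T ⟶ R` form a commutative ring under the internal operations of `R`. -/
structure Satisfies {R L : 𝓔} [CommRingObj R] (hL : InternalDistribLattice L)
    (d : R ⟶ L) : Prop where
  one {T : 𝓔} : (1 : T ⟶ R) ≫ d = toUnit T ≫ hL.top
  inf_neg {T : 𝓔} (a : T ⟶ R) : lift (a ≫ d) ((-a) ≫ d) ≫ hL.inf = toUnit T ≫ hL.bot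
  neg_sq {T : 𝓔} (b : T ⟶ R) : (-(b * b)) ≫ d = toUnit T ≫ hL.bot
  add {T : 𝓔} (a b : T ⟶ R) :
    lift ((a + b) ≫ d) (lift (a ≫ d) (b ≫ d) ≫ hL.sup) ≫ hL.sup =
      lift (a ≫ d) (b ≫ d) ≫ hL.sup
  mul {T : 𝓔} (a b : T ⟶ R) :
    (a * b) ≫ d =
      lift (lift (a ≫ d) (b ≫ d) ≫ hL.inf)
        (lift ((-a) ≫ d) ((-b) ≫ d) ≫ hL.inf) ≫ hL.sup

/-- `(L, d)` is the internal distributive lattice freely generated by the symbols `D_a`, `a` of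
type `R`, subject to the five spectrum relations. -/
def IsSpectralLattice {R L : 𝓔} [CommRingObj R] (hL : InternalDistribLattice L)
    (d : R ⟶ L) : Prop :=
  hL.Satisfies d ∧
    ∀ (M : 𝓔) (hM : InternalDistribLattice M) (f : R ⟶ M), hM.Satisfies f →
      ∃! g : L ⟶ M, hL.IsHom hM g ∧ d ≫ g = f

end InternalDistribLattice

end Internal

/-! ## The topos of a C⋆-algebra and its Bohrification -/

/-- The poset `𝒞(A)` of unital commutative C⋆-subalgebras of `A`, ordered by inclusion. -/
abbrev CommSubalg (A : Type u) [CStarAlgebra A] : Type u :=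
  {C : StarSubalgebra ℂ A // IsClosed (C : Set A) ∧ ∀ x ∈ C, ∀ y ∈ C, x * y = y * x}

namespace CommSubalg

variable {A : Type u} [CStarAlgebra A]

noncomputable instance instCommCStarAlgebra (C : CommSubalg A) : CommCStarAlgebra C.1 :=
  haveI : IsClosed (C.1 : Set A) := C.2.1
  { (StarSubalgebra.cstarAlgebra C.1 : CStarAlgebra C.1) with
    mul_comm := fun x y => Subtype.ext (C.2.2 x.1 x.2 y.1 y.2) }

/-- The inclusion `C ⊆ D`. -/
noncomputable def incl {C D : CommSubalg A} (h : C ≤ D) : C.1 →⋆ₐ[ℂ] D.1 :=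
  StarSubalgebra.inclusion h

/-- The inclusion `C_sa ⊆ D_sa`. -/
noncomputable def inclSA {C D : CommSubalg A} (h : C ≤ D) :
    selfAdjoint C.1 →+* selfAdjoint D.1 where
  toFun c := ⟨incl h c.1, c.2.map (incl h)⟩
  map_one' := rfl
  map_mul' _ _ := rfl
  map_zero' := rfl
  map_add' _ _ := rfl

end CommSubalg


section Bohrification

variable (A : Type u) [CStarAlgebra A]

/-- The Bohrification of `A`: the tautological functor `C ↦ C` in the topos of functors from
`𝒞(A)` to `Sets`, with the inclusions as transition maps. -/
noncomputable def bohrification : CommSubalg A ⥤ Type u where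
  obj C := C.1
  map h := TypeCat.ofHom (CommSubalg.incl h.le)

/-- The involution of the Bohrification. -/
noncomputable def bohrificationStar : bohrification A ⟶ bohrification A where
  app C := TypeCat.ofHom fun c : C.1 => (star c : C.1)

/-- The self-adjoint part of the Bohrification: `C ↦ C_sa`. -/
noncomputable def bohrificationSA : CommSubalg A ⥤ Type u where
  obj C := selfAdjoint C.1
  map h := TypeCat.ofHom (CommSubalg.inclSA h.le)

/-- The inclusion of the self-adjoint part. -/
noncomputable def bohrificationSAIncl : bohrificationSA A ⟶ bohrification A where
  app C := TypeCat.ofHom fun c : selfAdjoint C.1 => c.1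

theorem bohrificationSAIncl_condition :
    bohrificationSAIncl A ≫ bohrificationStar A = bohrificationSAIncl A ≫ 𝟙 _ := by
  ext C c
  exact c.2

/-- The self-adjoint part is internally the subobject `{a | a⋆ = a}` of the Bohrification. -/
theorem bohrificationSA_isEqualizer :
    Nonempty (Limits.IsLimit
      (Limits.Fork.ofι (bohrificationSAIncl A) (bohrificationSAIncl_condition A))) := by
  refine ⟨Limits.Fork.IsLimit.mk' _ fun s =>
    ⟨{ app := fun C => TypeCat.ofHom fun x => (⟨s.ι.app C x, ?_⟩ : selfAdjoint C.1)
       naturality := ?_ }, ?_, ?_⟩⟩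
  · exact ConcreteCategory.congr_hom (NatTrans.congr_app s.condition C) x
  · intro C D h
    ext x
    exact Subtype.ext
      (congrArg (fun f => (ConcreteCategory.hom f).toFun x) (s.ι.naturality h))
  · ext C x
    rfl
  · intro m hm
    ext C x
    exact Subtype.ext
      (congrArg (fun f => (ConcreteCategory.hom (NatTrans.app f C)).toFun x) hm)

/-- The internal commutative ring structure on the self-adjoint part of the Bohrification, with
the operations of `C_sa` at stage `C`. -/
noncomputable instance bohrificationSARing : CommRingObj (bohrificationSA A) where
  zero := { app := fun C => TypeCat.ofHom fun _ => (0 : selfAdjoint C.1) }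
  add := { app := fun C => TypeCat.ofHom fun p : selfAdjoint C.1 × selfAdjoint C.1 => p.1 + p.2 }
  neg := { app := fun C => TypeCat.ofHom fun c : selfAdjoint C.1 => -c }
  one := { app := fun C => TypeCat.ofHom fun _ => (1 : selfAdjoint C.1) }
  mul := { app := fun C => TypeCat.ofHom fun p : selfAdjoint C.1 × selfAdjoint C.1 => p.1 * p.2 }
  zero_add := by
    ext C p
    exact zero_add (M := selfAdjoint C.1) _
  add_zero := by
    ext C p
    exact add_zero (M := selfAdjoint C.1) _
  add_assoc := by
    ext C p
    exact add_assoc (G := selfAdjoint C.1) _ _ _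
  left_neg := by
    ext C p
    exact neg_add_cancel (G := selfAdjoint C.1) _
  right_neg := by
    ext C p
    exact add_neg_cancel (G := selfAdjoint C.1) _
  add_comm := by
    ext C p
    exact add_comm (G := selfAdjoint C.1) _ _
  one_mul := by
    ext C p
    exact one_mul (M := selfAdjoint C.1) _
  mul_one := by
    ext C p
    exact mul_one (M := selfAdjoint C.1) _
  mul_assoc := by
    ext C p
    exact mul_assoc (G := selfAdjoint C.1) _ _ _
  mul_add := by
    ext C p
    exact mul_add (R := selfAdjoint C.1) _ _ _
  add_mul := by
    ext C p
    exact add_mul (R := selfAdjoint C.1) _ _ _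
  mul_comm := by
    ext C p
    exact mul_comm (G := selfAdjoint C.1) _ _

/-- The functor `C ↦ L_C`, where a transition map `L_C → L_D` sends `D_c` to `D_c`. -/
noncomputable def localLattice : CommSubalg A ⥤ Type u where
  obj C := SpectralLattice (selfAdjoint C.1)
  map h := TypeCat.ofHom (SpectralLattice.map (CommSubalg.inclSA h.le))
  map_id C := by
    ext x
    exact DFunLike.congr_fun (SpectralLattice.map_id (selfAdjoint C.1)) x
  map_comp f g := by
    ext x
    exact DFunLike.congr_fun
      (SpectralLattice.map_comp (CommSubalg.inclSA f.le) (CommSubalg.inclSA g.le)) x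

/-- The stagewise lattice operations on the functor `C ↦ L_C`. -/
noncomputable def localLatticeStr : InternalDistribLattice (localLattice A) where
  top := { app := fun C => TypeCat.ofHom fun _ => (⊤ : SpectralLattice (selfAdjoint C.1)) }
  bot := { app := fun C => TypeCat.ofHom fun _ => (⊥ : SpectralLattice (selfAdjoint C.1)) }
  inf :=
    { app := fun C => TypeCat.ofHom
        fun p => min (α := SpectralLattice (selfAdjoint C.1)) p.1 p.2
      naturality := by
        intro C D h
        ext p
        exact ((SpectralLattice.map (CommSubalg.inclSA h.le)).map_inf' p.1 p.2).symm }
  sup :=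
    { app := fun C => TypeCat.ofHom
        fun p => max (α := SpectralLattice (selfAdjoint C.1)) p.1 p.2
      naturality := by
        intro C D h
        ext p
        exact ((SpectralLattice.map (CommSubalg.inclSA h.le)).map_sup' p.1 p.2).symm }
  inf_comm x y := by
    ext C p
    exact inf_comm (α := SpectralLattice (selfAdjoint C.1)) _ _
  sup_comm x y := by
    ext C p
    exact sup_comm (α := SpectralLattice (selfAdjoint C.1)) _ _
  inf_assoc x y z := by
    ext C p
    exact inf_assoc (α := SpectralLattice (selfAdjoint C.1)) _ _ _
  sup_assoc x y z := by
    ext C p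
    exact sup_assoc (α := SpectralLattice (selfAdjoint C.1)) _ _ _
  inf_sup_self x y := by
    ext C p
    exact inf_sup_self (α := SpectralLattice (selfAdjoint C.1))
  sup_inf_self x y := by
    ext C p
    exact sup_inf_self (α := SpectralLattice (selfAdjoint C.1))
  inf_sup_distrib x y z := by
    ext C p
    exact inf_sup_left (α := SpectralLattice (selfAdjoint C.1)) _ _ _
  inf_top x := by
    ext C p
    exact inf_top_eq (α := SpectralLattice (selfAdjoint C.1)) _
  sup_bot x := by
    ext C p
    exact sup_bot_eq (α := SpectralLattice (selfAdjoint C.1)) _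

/-- The morphism `c ↦ D_c` from `C ↦ C_sa` to `C ↦ L_C`. -/
noncomputable def localLatticeGen : bohrificationSA A ⟶ localLattice A where
  app C := TypeCat.ofHom fun c : selfAdjoint C.1 => SpectralLattice.D c

end Bohrification

namespace InternalDistribLattice

variable {J : Type u} [Category.{v} J] {L : J ⥤ Type w} (hL : InternalDistribLattice L) (j : J)

/-- The top element of an internal lattice at stage `j`. -/
def topAt : L.obj j := hL.top.app j PUnit.unit

/-- The bottom element of an internal lattice at stage `j`. -/
def botAt : L.obj j := hL.bot.app j PUnit.unit

/-- The meet of an internal lattice at stage `j`. -/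
def infAt (x y : L.obj j) : L.obj j := hL.inf.app j (x, y)

/-- The join of an internal lattice at stage `j`. -/
def supAt (x y : L.obj j) : L.obj j := hL.sup.app j (x, y)

end InternalDistribLattice

/-! ### Consequences of the spectrum relations in a commutative ring. -/

namespace SpectralLattice

variable {R : Type u} [CommRing R]

/-! Locality: bounded distributive lattices and the spectrum relations are equational, so an
internal model in a functor topos is the same as a functor of models in sets. Hence the stagewise
free lattices, with the induced transition maps, have the internal universal property
(`isSpectralLattice_localLattice`), and any other internal model is isomorphic to them by uniqueness
of initial objects.

The comparison of `L_C` with `C⁺/≈`: by Gelfand duality `C_sa` is a ring of continuous real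
functions in which the positive elements are the squares, and every element of `L_C` is `D_a` with
`a` a square (`exists_isSquare_D_eq`). The assignment `D_a ↦ [a⁺]` does not respect the product
relation, since `D_{a²} = D_a` for positive `a` while `a²` and `a` need not be `≈`-equivalent. In
`L_C` it suffices for `D_a ≤ D_b` that `a ^ m ≤ n b` for some `m ≥ 1` and `n`, whereas `C⁺/≈` allows
only multiples. The function `Real.logGauge`, `1 / (1 - log t)` near `0`, turns powers into
multiples, so `D_a ↦ [logGauge(a)]` satisfies the relations (`satisfies_mk_gauge`). It reflects the
order by `D_le_D_of_dominated` and is onto because `logGauge` has the continuous right inverse `s ↦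
e · exp(-1/s)` on `[0, 1]`, with value `0` at `s = 0`.

Injectivity of `L_C → L_D` then reduces to `C⁺/≈`, where it holds because an inequality `p ≤ n q`
valid in `D` already holds in `C` (`dominated_of_map`). -/

theorem D_zero : D (0 : R) = ⊥ := by
  simpa using satisfies_D.neg_sq (0 : R)

theorem D_le_of_isSquare_sub {a b : R} (h : IsSquare (b - a)) : D a ≤ D b := by
  obtain ⟨c, hc⟩ := h
  have e : a = b + -(c * c) := by rw [← hc]; ring
  calc D a = D (b + -(c * c)) := by rw [← e]
    _ ≤ D b ⊔ D (-(c * c)) := satisfies_D.add _ _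
    _ = D b := by rw [satisfies_D.neg_sq, sup_bot_eq]

theorem D_nsmul_le (n : ℕ) (a : R) : D (n • a) ≤ D a := by
  induction n with
  | zero => rw [zero_nsmul, D_zero]; exact bot_le
  | succ n ih => rw [succ_nsmul]; exact (satisfies_D.add _ _).trans (sup_le ih le_rfl)

theorem D_neg_of_isSquare {a : R} (h : IsSquare a) : D (-a) = ⊥ := by
  obtain ⟨c, rfl⟩ := h
  exact satisfies_D.neg_sq c

/-- The second meet in the product relation contains `D (-a) = ⊥`. No sign condition on `b` is
needed, which is what allows `b` to be a difference of squares below. -/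
theorem D_mul_of_isSquare {a : R} (h : IsSquare a) (b : R) : D (a * b) = D a ⊓ D b := by
  rw [satisfies_D.mul, D_neg_of_isSquare h, bot_inf_eq, sup_bot_eq]

theorem D_add_of_isSquare {a b : R} (ha : IsSquare a) (hb : IsSquare b) :
    D (a + b) = D a ⊔ D b :=
  le_antisymm (satisfies_D.add _ _)
    (sup_le (D_le_of_isSquare_sub (by simpa using hb)) (D_le_of_isSquare_sub (by simpa using ha)))

theorem D_pow_succ_of_isSquare {a : R} (h : IsSquare a) (n : ℕ) : D (a ^ (n + 1)) = D a := by
  induction n with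
  | zero => simp
  | succ n ih => rw [pow_succ', D_mul_of_isSquare h, ih, inf_idem]

/-- If every element of `R` is a difference of squares with product zero, and the squares are
closed under addition, then every element of the lattice is of the form `D_a` with `a` a square. -/
theorem exists_isSquare_D_eq
    (hadd : ∀ a b : R, IsSquare a → IsSquare b → IsSquare (a + b))
    (hpart : ∀ a : R, ∃ p q : R, IsSquare p ∧ IsSquare q ∧ a = p - q ∧ p * q = 0)
    (x : SpectralLattice R) : ∃ a : R, IsSquare a ∧ D a = x := by
  induction x using Quotient.inductionOn with | _ s
  induction s with
  | gen a =>
    obtain ⟨p, q, hp, hq, rfl, hpq⟩ := hpart a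
    refine ⟨p, hp, le_antisymm ?_ (D_le_of_isSquare_sub (by simpa using hq))⟩
    -- The positive part `p` satisfies `D p ⊓ D (p - q) = D (p * p) = D p`, hence `D p ≤ D (p - q)`.
    have e : p * (p - q) = p * p := by rw [mul_sub, hpq, sub_zero]
    have h := D_mul_of_isSquare hp (p - q)
    rw [e, D_mul_of_isSquare hp, inf_idem] at h
    exact h.le.trans inf_le_right
  | top => exact ⟨1, IsSquare.one, satisfies_D.one⟩
  | bot => exact ⟨0, IsSquare.zero, D_zero⟩
  | inf s t hs ht =>
    obtain ⟨a, ha, has⟩ := hs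
    obtain ⟨b, hb, hbt⟩ := ht
    exact ⟨a * b, ha.mul hb, (D_mul_of_isSquare ha b).trans (congrArg₂ (· ⊓ ·) has hbt)⟩
  | sup s t hs ht =>
    obtain ⟨a, ha, has⟩ := hs
    obtain ⟨b, hb, hbt⟩ := ht
    exact ⟨a + b, hadd a b ha hb, (D_add_of_isSquare ha hb).trans (congrArg₂ (· ⊔ ·) has hbt)⟩

end SpectralLattice

/-! ### Internal lattices in a functor topos and their stages. -/

namespace InternalDistribLattice

section Hom

variable {𝓔 : Type u} [Category.{v} 𝓔] [CartesianMonoidalCategory 𝓔] {L M N : 𝓔}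
  {hL : InternalDistribLattice L} {hM : InternalDistribLattice M} {hN : InternalDistribLattice N}

theorem IsHom.id (hL : InternalDistribLattice L) : hL.IsHom hL (𝟙 L) where
  top := Category.comp_id _
  bot := Category.comp_id _
  inf x y := by simp only [Category.comp_id]
  sup x y := by simp only [Category.comp_id]

theorem IsHom.comp {g : L ⟶ M} {k : M ⟶ N} (hg : hL.IsHom hM g) (hk : hM.IsHom hN k) :
    hL.IsHom hN (g ≫ k) where
  top := by rw [← Category.assoc, hg.top, hk.top]
  bot := by rw [← Category.assoc, hg.bot, hk.bot]
  inf x y := by rw [← Category.assoc, hg.inf, hk.inf, Category.assoc, Category.assoc]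
  sup x y := by rw [← Category.assoc, hg.sup, hk.sup, Category.assoc, Category.assoc]

/-- Two internal lattices presented by the spectrum relations are isomorphic. -/
theorem IsSpectralLattice.exists_iso [BraidedCategory 𝓔] {R : 𝓔} [CommRingObj R]
    {d : R ⟶ L} {d' : R ⟶ M} (h : hL.IsSpectralLattice d) (h' : hM.IsSpectralLattice d') :
    ∃ i : L ≅ M, hL.IsHom hM i.hom ∧ d ≫ i.hom = d' := by
  obtain ⟨g, ⟨hg, hgd⟩, -⟩ := h.2 M hM d' h'.1
  obtain ⟨k, ⟨hk, hkd⟩, -⟩ := h'.2 L hL d h.1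
  refine ⟨⟨g, k, ?_, ?_⟩, hg, hgd⟩
  · exact (h.2 L hL d h.1).unique ⟨hg.comp hk, by rw [← Category.assoc, hgd, hkd]⟩
      ⟨IsHom.id hL, Category.comp_id d⟩
  · exact (h'.2 M hM d' h'.1).unique ⟨hk.comp hg, by rw [← Category.assoc, hkd, hgd]⟩
      ⟨IsHom.id hM, Category.comp_id d'⟩

end Hom

section Stage

variable {J : Type u} [Category.{v} J] {L : J ⥤ Type w} (hL : InternalDistribLattice L) (j : J)

theorem app_eq {T : J ⥤ Type w} {x y : T ⟶ L} (h : x = y) (j : J) (t : T.obj j) :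
    x.app j t = y.app j t := by rw [h]

/-- The lattice of elements of an internal lattice at a given stage. -/
abbrev latticeAt : Lattice (L.obj j) :=
  letI : Max (L.obj j) := ⟨hL.supAt j⟩
  letI : Min (L.obj j) := ⟨hL.infAt j⟩
  Lattice.mk'
    -- An identity between generalized elements becomes one between elements of `L.obj j` by taking
    -- the projections from `L ⊗ L` or `L ⊗ (L ⊗ L)` as generic elements.
    (fun a b => app_eq (hL.sup_comm (fst L L) (snd L L)) j (a, b))
    (fun a b c => app_eq (hL.sup_assoc (fst L (L ⊗ L)) (snd L (L ⊗ L) ≫ fst L L)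
      (snd L (L ⊗ L) ≫ snd L L)) j (a, b, c))
    (fun a b => app_eq (hL.inf_comm (fst L L) (snd L L)) j (a, b))
    (fun a b c => app_eq (hL.inf_assoc (fst L (L ⊗ L)) (snd L (L ⊗ L) ≫ fst L L)
      (snd L (L ⊗ L) ≫ snd L L)) j (a, b, c))
    (fun a b => app_eq (hL.sup_inf_self (fst L L) (snd L L)) j (a, b))
    (fun a b => app_eq (hL.inf_sup_self (fst L L) (snd L L)) j (a, b))

/-- The distributive lattice of elements of an internal lattice at a given stage. -/
abbrev distribLatticeAt : DistribLattice (L.obj j) :=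
  letI := hL.latticeAt j
  DistribLattice.ofInfSupLe fun a b c =>
    le_of_eq (app_eq (hL.inf_sup_distrib (fst L (L ⊗ L)) (snd L (L ⊗ L) ≫ fst L L)
      (snd L (L ⊗ L) ≫ snd L L)) j (a, b, c))

/-- The bounds of the lattice of elements of an internal lattice at a given stage. -/
abbrev boundedOrderAt : letI := hL.distribLatticeAt j; BoundedOrder (L.obj j) :=
  letI := hL.distribLatticeAt j
  { top := hL.topAt j
    bot := hL.botAt j
    le_top := fun a => inf_eq_left.mp (app_eq (hL.inf_top (𝟙 L)) j a)
    bot_le := fun a => sup_eq_left.mp (app_eq (hL.sup_bot (𝟙 L)) j a) }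

variable {hL} {M : J ⥤ Type w} {hM : InternalDistribLattice M} {g : L ⟶ M}

theorem IsHom.map_topAt (hg : hL.IsHom hM g) : g.app j (hL.topAt j) = hM.topAt j :=
  app_eq hg.top j PUnit.unit

theorem IsHom.map_botAt (hg : hL.IsHom hM g) : g.app j (hL.botAt j) = hM.botAt j :=
  app_eq hg.bot j PUnit.unit

theorem IsHom.map_infAt (hg : hL.IsHom hM g) (x y : L.obj j) :
    g.app j (hL.infAt j x y) = hM.infAt j (g.app j x) (g.app j y) :=
  app_eq (hg.inf (fst L L) (snd L L)) j (x, y)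

theorem IsHom.map_supAt (hg : hL.IsHom hM g) (x y : L.obj j) :
    g.app j (hL.supAt j x y) = hM.supAt j (g.app j x) (g.app j y) :=
  app_eq (hg.sup (fst L L) (snd L L)) j (x, y)

theorem map_topAt (hL : InternalDistribLattice L) {j k : J} (f : j ⟶ k) :
    L.map f (hL.topAt j) = hL.topAt k :=
  (ConcreteCategory.congr_hom (hL.top.naturality f) PUnit.unit).symm

theorem map_botAt (hL : InternalDistribLattice L) {j k : J} (f : j ⟶ k) :
    L.map f (hL.botAt j) = hL.botAt k :=
  (ConcreteCategory.congr_hom (hL.bot.naturality f) PUnit.unit).symm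

theorem map_infAt (hL : InternalDistribLattice L) {j k : J} (f : j ⟶ k) (x y : L.obj j) :
    L.map f (hL.infAt j x y) = hL.infAt k (L.map f x) (L.map f y) :=
  (ConcreteCategory.congr_hom (X := (L ⊗ L).obj j) (hL.inf.naturality f)
    ((x, y) : L.obj j × L.obj j)).symm

theorem map_supAt (hL : InternalDistribLattice L) {j k : J} (f : j ⟶ k) (x y : L.obj j) :
    L.map f (hL.supAt j x y) = hL.supAt k (L.map f x) (L.map f y) :=
  (ConcreteCategory.congr_hom (X := (L ⊗ L).obj j) (hL.sup.naturality f)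
    ((x, y) : L.obj j × L.obj j)).symm

/-- The transition maps of an internal lattice are lattice homomorphisms. -/
def mapHom (hL : InternalDistribLattice L) {j k : J} (f : j ⟶ k) :
    letI := hL.distribLatticeAt j; letI := hL.boundedOrderAt j
    letI := hL.distribLatticeAt k; letI := hL.boundedOrderAt k
    BoundedLatticeHom (L.obj j) (L.obj k) :=
  letI := hL.distribLatticeAt j; letI := hL.boundedOrderAt j
  letI := hL.distribLatticeAt k; letI := hL.boundedOrderAt k
  { toFun := fun x => L.map f x
    map_sup' := hL.map_supAt f
    map_inf' := hL.map_infAt f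
    map_top' := hL.map_topAt f
    map_bot' := hL.map_botAt f }

end Stage

/-! ### The stagewise free lattices have the internal universal property. -/

section Bohrification

variable {A : Type u} [CStarAlgebra A]

theorem satisfies_localLatticeGen : (localLatticeStr A).Satisfies (localLatticeGen A) where
  one := by
    intros; ext C t
    exact SpectralLattice.satisfies_D.one
  inf_neg a := by
    ext C t
    exact SpectralLattice.satisfies_D.inf_neg (R := selfAdjoint C.1) (a.app C t)
  neg_sq b := by
    ext C t
    exact SpectralLattice.satisfies_D.neg_sq (R := selfAdjoint C.1) (b.app C t)
  add a b := by
    ext C t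
    exact sup_eq_right (α := SpectralLattice (selfAdjoint C.1)).mpr
      (SpectralLattice.satisfies_D.add (R := selfAdjoint C.1) (a.app C t) (b.app C t))
  mul a b := by
    ext C t
    exact SpectralLattice.satisfies_D.mul (R := selfAdjoint C.1) (a.app C t) (b.app C t)

variable {M : CommSubalg A ⥤ Type u} {hM : InternalDistribLattice M} {f : bohrificationSA A ⟶ M}

/-- The internal relations are evaluated at generic elements: the identity of the ring object for
one variable, the two projections for two. -/
theorem Satisfies.satisfies_app (hf : hM.Satisfies f) (C : CommSubalg A) :
    letI := hM.distribLatticeAt C; letI := hM.boundedOrderAt C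
    SpectralLattice.Satisfies fun c : selfAdjoint C.1 => f.app C c :=
  letI := hM.distribLatticeAt C; letI := hM.boundedOrderAt C
  let R := bohrificationSA A
  { one := app_eq (hf.one (T := 𝟙_ _)) C PUnit.unit
    inf_neg := fun a => app_eq (hf.inf_neg (𝟙 R)) C a
    neg_sq := fun b => app_eq (hf.neg_sq (𝟙 R)) C b
    add := fun a b => sup_eq_right.mp (app_eq (hf.add (fst R R) (snd R R)) C (a, b))
    mul := fun a b => app_eq (hf.mul (fst R R) (snd R R)) C (a, b) }

/-- The morphism of functors determined by the stagewise universal property. -/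
noncomputable def localLatticeLift (hf : hM.Satisfies f) : localLattice A ⟶ M where
  app C :=
    letI := hM.distribLatticeAt C; letI := hM.boundedOrderAt C
    TypeCat.ofHom (SpectralLattice.lift _ (hf.satisfies_app C))
  naturality C D h := by
    let := hM.distribLatticeAt C; let := hM.boundedOrderAt C
    let := hM.distribLatticeAt D; let := hM.boundedOrderAt D
    -- Both composites are homomorphisms out of `L_C`, so naturality need only be checked on
    -- generators, where it is naturality of `f`.
    have e : (SpectralLattice.lift _ (hf.satisfies_app D)).comp
          (SpectralLattice.map (CommSubalg.inclSA h.le)) =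
        (hM.mapHom h).comp (SpectralLattice.lift _ (hf.satisfies_app C)) :=
      SpectralLattice.hom_ext fun c => ConcreteCategory.congr_hom (f.naturality h) c
    ext x
    exact DFunLike.congr_fun e x

theorem isHom_localLatticeLift (hf : hM.Satisfies f) :
    (localLatticeStr A).IsHom hM (localLatticeLift hf) where
  top := by ext C t; rfl
  bot := by ext C t; rfl
  inf x y := by
    ext C t
    let := hM.distribLatticeAt C; let := hM.boundedOrderAt C
    exact map_inf (SpectralLattice.lift _ (hf.satisfies_app C)) _ _
  sup x y := by
    ext C t
    let := hM.distribLatticeAt C; let := hM.boundedOrderAt C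
    exact map_sup (SpectralLattice.lift _ (hf.satisfies_app C)) _ _

theorem localLattice_hom_ext {g g' : localLattice A ⟶ M} (hg : (localLatticeStr A).IsHom hM g)
    (hg' : (localLatticeStr A).IsHom hM g') (h : localLatticeGen A ≫ g = localLatticeGen A ≫ g') :
    g = g' := by
  ext C x
  let := hM.distribLatticeAt C; let := hM.boundedOrderAt C
  let k (g : localLattice A ⟶ M) (hg : (localLatticeStr A).IsHom hM g) :
      BoundedLatticeHom (SpectralLattice (selfAdjoint C.1)) (M.obj C) :=
    { toFun := fun x => g.app C x
      map_sup' := hg.map_supAt C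
      map_inf' := hg.map_infAt C
      map_top' := hg.map_topAt C
      map_bot' := hg.map_botAt C }
  have e : k g hg = k g' hg' := SpectralLattice.hom_ext fun c => app_eq h C c
  exact DFunLike.congr_fun e x

variable (A) in
theorem isSpectralLattice_localLattice :
    (localLatticeStr A).IsSpectralLattice (localLatticeGen A) := by
  refine ⟨satisfies_localLatticeGen, fun M hM f hf => ⟨localLatticeLift hf,
    ⟨isHom_localLatticeLift hf, by ext C c; rfl⟩, fun g hg => ?_⟩⟩
  refine localLattice_hom_ext hg.1 (isHom_localLatticeLift hf) (hg.2.trans ?_)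
  ext C c
  rfl

end Bohrification

end InternalDistribLattice

/-! ### Gelfand duality for self-adjoint elements. -/

open WeakDual in
/-- The Gelfand transform, as an isomorphism between the ring of self-adjoint elements and the ring
of continuous real-valued functions on the character space. -/
noncomputable def selfAdjoint.gelfandEquiv (B : Type u) [CommCStarAlgebra B] :
    selfAdjoint B ≃+* C(characterSpace ℂ B, ℝ) where
  toFun a := ⟨fun χ => (gelfandStarTransform B a χ).re, by fun_prop⟩
  invFun f := ⟨(gelfandStarTransform B).symm ⟨fun χ => (f χ : ℂ), by fun_prop⟩, by
    rw [selfAdjoint.mem_iff, ← map_star]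
    congr 1
    ext χ
    exact Complex.conj_ofReal _⟩
  left_inv a := by
    apply Subtype.ext
    refine (StarAlgEquiv.symm_apply_eq _ ).2 ?_
    ext χ
    refine Complex.conj_eq_iff_re.1 ?_
    have h := map_star (gelfandStarTransform B) a.1
    rw [a.2] at h
    exact (DFunLike.congr_fun h χ).symm
  right_inv f := by
    ext χ
    exact congrArg (fun g => (g χ).re) ((gelfandStarTransform B).apply_symm_apply _)
  map_add' a b := by
    ext χ
    simp
  map_mul' a b := by
    ext χ
    -- Taking real parts is multiplicative here only because characters are real on self-adjoint
    -- elements.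
    have h (c : selfAdjoint B) : (gelfandStarTransform B c χ).im = 0 := by
      refine Complex.conj_eq_iff_im.1 ?_
      have h := map_star (gelfandStarTransform B) c.1
      rw [c.2] at h
      exact (DFunLike.congr_fun h χ).symm
    change (gelfandStarTransform B (a.1 * b.1) χ).re = _
    rw [map_mul, ContinuousMap.mul_apply, Complex.mul_re, h, zero_mul, sub_zero]
    rfl

namespace selfAdjoint

open WeakDual

variable {B : Type u} [CommCStarAlgebra B]

theorem ofReal_gelfandEquiv (a : selfAdjoint B) (χ : characterSpace ℂ B) :
    ((gelfandEquiv B a χ : ℝ) : ℂ) = χ a.1 := by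
  refine Complex.conj_eq_iff_re.1 ?_
  have h := map_star (gelfandStarTransform B) a.1
  rw [a.2] at h
  exact (DFunLike.congr_fun h χ).symm

/-- A nonnegative continuous function has a continuous square root. This makes positivity a
ring-theoretic notion, to which the spectrum relations apply. -/
theorem gelfandEquiv_nonneg_iff {a : selfAdjoint B} : 0 ≤ gelfandEquiv B a ↔ IsSquare a := by
  constructor
  · intro h
    refine ⟨(gelfandEquiv B).symm ⟨fun χ => √(gelfandEquiv B a χ), by fun_prop⟩, ?_⟩
    apply (gelfandEquiv B).injective
    ext χ
    simpa using (Real.mul_self_sqrt (h χ)).symm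
  · rintro ⟨c, rfl⟩ χ
    simpa using mul_self_nonneg (gelfandEquiv B c χ)

theorem isSquare_iff {a : selfAdjoint B} : IsSquare a ↔ ∃ c : B, a.1 = star c * c := by
  constructor
  · rintro ⟨c, rfl⟩
    exact ⟨c.1, by rw [c.2]; rfl⟩
  · rintro ⟨c, hc⟩
    refine gelfandEquiv_nonneg_iff.1 fun χ => ?_
    have h := ofReal_gelfandEquiv a χ
    have e : gelfandEquiv B a χ = (χ a.1).re := by rw [← h, Complex.ofReal_re]
    change 0 ≤ gelfandEquiv B a χ
    rw [e, hc, map_mul, map_star]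
    simpa using add_nonneg (mul_self_nonneg (χ c).re) (mul_self_nonneg (χ c).im)

theorem isSquare_sub_iff {a b : selfAdjoint B} :
    IsSquare (b - a) ↔ gelfandEquiv B a ≤ gelfandEquiv B b := by
  rw [← gelfandEquiv_nonneg_iff, map_sub, sub_nonneg]

theorem isSquare_add {a b : selfAdjoint B} (ha : IsSquare a) (hb : IsSquare b) :
    IsSquare (a + b) := by
  rw [← gelfandEquiv_nonneg_iff] at *
  rw [map_add]
  exact add_nonneg ha hb

theorem exists_eq_sub_of_isSquare (a : selfAdjoint B) :
    ∃ p q : selfAdjoint B, IsSquare p ∧ IsSquare q ∧ a = p - q ∧ p * q = 0 := by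
  let f := gelfandEquiv B a
  refine ⟨(gelfandEquiv B).symm (f ⊔ 0), (gelfandEquiv B).symm (-f ⊔ 0), ?_, ?_, ?_, ?_⟩
  · rw [← gelfandEquiv_nonneg_iff, RingEquiv.apply_symm_apply]
    exact le_sup_right
  · rw [← gelfandEquiv_nonneg_iff, RingEquiv.apply_symm_apply]
    exact le_sup_right
  · rw [← map_sub, RingEquiv.eq_symm_apply]
    ext χ
    change f χ = max (f χ) 0 - max (-f χ) 0
    rcases le_total (f χ) 0 with h | h
    · rw [max_eq_right h, max_eq_left (by linarith)]; ring
    · rw [max_eq_left h, max_eq_right (by linarith)]; ring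
  · rw [← map_mul, RingEquiv.symm_apply_eq, map_zero]
    ext χ
    change max (f χ) 0 * max (-f χ) 0 = 0
    rcases le_total (f χ) 0 with h | h
    · rw [max_eq_right h, zero_mul]
    · rw [max_eq_right (a := -f χ) (by linarith), mul_zero]

theorem gelfandEquiv_map {B' : Type v} [CommCStarAlgebra B'] (f : B →⋆ₐ[ℂ] B')
    (a : selfAdjoint B) (χ : characterSpace ℂ B') :
    gelfandEquiv B' ⟨f a.1, a.2.map f⟩ χ =
      gelfandEquiv B a (CharacterSpace.compContinuousMap f χ) := rfl

/-- Nonnegativity of a function on the character space can be tested on the characters that extend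
along an injective homomorphism. -/
theorem nonneg_of_comp_nonneg {B' : Type v} [CommCStarAlgebra B'] {f : B →⋆ₐ[ℂ] B'}
    (hf : Function.Injective f) {g : C(characterSpace ℂ B, ℝ)}
    (h : ∀ χ, 0 ≤ g (CharacterSpace.compContinuousMap f χ)) : 0 ≤ g := by
  -- The negative part of `g` vanishes at every character restricted from `B'`, so its image under
  -- `f` is zero; injectivity of `f` makes it zero itself.
  let q := (gelfandEquiv B).symm (-g ⊔ 0)
  have hq : gelfandEquiv B q = -g ⊔ 0 := RingEquiv.apply_symm_apply _ _
  have hfq : (⟨f q.1, q.2.map f⟩ : selfAdjoint B') = 0 := by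
    rw [← (gelfandEquiv B').map_eq_zero_iff]
    ext χ
    rw [gelfandEquiv_map, hq]
    exact max_eq_right (neg_nonpos.2 (h χ))
  have hq0 : q = 0 := Subtype.ext (hf ((congrArg Subtype.val hfq).trans (map_zero f).symm))
  rw [hq0, map_zero] at hq
  intro χ
  have h0 : 0 = max (-g χ) 0 := DFunLike.congr_fun hq χ
  exact neg_nonpos.1 (max_eq_right_iff.1 h0.symm)

end selfAdjoint

/-! ### Positive elements as nonnegative functions, and their lattice structure. -/

namespace PosElem

open WeakDual selfAdjoint

variable {B : Type u} [CommCStarAlgebra B]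

/-- A positive element as a self-adjoint element. -/
def toSelfAdjoint (p : PosElem B) : selfAdjoint B :=
  ⟨p.1, by
    obtain ⟨c, hc⟩ := p.2
    rw [hc]
    exact IsSelfAdjoint.star_mul_self c⟩

/-- The Gelfand transform of a positive element. -/
noncomputable def toFun (p : PosElem B) : C(characterSpace ℂ B, ℝ) :=
  gelfandEquiv B p.toSelfAdjoint

/-- The positive element with a given nonnegative Gelfand transform. -/
noncomputable def ofFun (f : C(characterSpace ℂ B, ℝ)) (hf : 0 ≤ f) : PosElem B :=
  ⟨(gelfandEquiv B).symm f, isSquare_iff.1 <|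
    gelfandEquiv_nonneg_iff.1 <| by rwa [RingEquiv.apply_symm_apply]⟩

@[simp]
theorem toFun_ofFun (f : C(characterSpace ℂ B, ℝ)) (hf : 0 ≤ f) : (ofFun f hf).toFun = f :=
  (gelfandEquiv B).apply_symm_apply f

theorem toFun_nonneg (p : PosElem B) : 0 ≤ p.toFun :=
  gelfandEquiv_nonneg_iff.2 (isSquare_iff.2 p.2)

theorem le_iff_toFun_le {p q : PosElem B} : p ≤ q ↔ p.toFun ≤ q.toFun := by
  rw [toFun, toFun, ← isSquare_sub_iff, isSquare_iff]
  rfl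

theorem toFun_nsmul (n : ℕ) (p : PosElem B) : (n • p).toFun = n • p.toFun :=
  map_nsmul (gelfandEquiv B) n p.toSelfAdjoint

theorem dominated_iff {p q : PosElem B} :
    Dominated p q ↔ ∃ n : ℕ, ∀ χ, p.toFun χ ≤ n * q.toFun χ := by
  refine exists_congr fun n => ?_
  rw [le_iff_toFun_le, toFun_nsmul, ContinuousMap.le_def]
  simp

theorem toFun_map {B' : Type v} [CommCStarAlgebra B'] (f : B →⋆ₐ[ℂ] B') (p : PosElem B)
    (χ : characterSpace ℂ B') :
    (p.map f).toFun χ = p.toFun (CharacterSpace.compContinuousMap f χ) :=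
  gelfandEquiv_map f p.toSelfAdjoint χ

theorem toFun_injective : Function.Injective (toFun : PosElem B → _) := fun _ _ h =>
  le_antisymm (le_iff_toFun_le.2 h.le) (le_iff_toFun_le.2 h.ge)

/-- Positive elements form a lattice. -/
noncomputable instance : Lattice (PosElem B) where
  sup p q := ofFun (p.toFun ⊔ q.toFun) (p.toFun_nonneg.trans le_sup_left)
  inf p q := ofFun (p.toFun ⊓ q.toFun) (le_inf p.toFun_nonneg q.toFun_nonneg)
  le_sup_left p q := le_iff_toFun_le.2 <| by rw [toFun_ofFun]; exact le_sup_left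
  le_sup_right p q := le_iff_toFun_le.2 <| by rw [toFun_ofFun]; exact le_sup_right
  sup_le p q r h h' := by
    rw [le_iff_toFun_le] at *
    rw [toFun_ofFun]
    exact sup_le h h'
  inf_le_left p q := le_iff_toFun_le.2 <| by rw [toFun_ofFun]; exact inf_le_left
  inf_le_right p q := le_iff_toFun_le.2 <| by rw [toFun_ofFun]; exact inf_le_right
  le_inf p q r h h' := by
    rw [le_iff_toFun_le] at *
    rw [toFun_ofFun]
    exact le_inf h h'

theorem toFun_sup (p q : PosElem B) (χ : characterSpace ℂ B) :
    (p ⊔ q).toFun χ = max (p.toFun χ) (q.toFun χ) :=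
  congrArg (· χ) (toFun_ofFun _ (p.toFun_nonneg.trans le_sup_left))

theorem toFun_inf (p q : PosElem B) (χ : characterSpace ℂ B) :
    (p ⊓ q).toFun χ = min (p.toFun χ) (q.toFun χ) :=
  congrArg (· χ) (toFun_ofFun _ (le_inf p.toFun_nonneg q.toFun_nonneg))

theorem map_sup {B' : Type v} [CommCStarAlgebra B'] (f : B →⋆ₐ[ℂ] B') (p q : PosElem B) :
    (p ⊔ q).map f = p.map f ⊔ q.map f :=
  toFun_injective <| by
    ext χ
    simp only [toFun_map, toFun_sup]

theorem map_inf {B' : Type v} [CommCStarAlgebra B'] (f : B →⋆ₐ[ℂ] B') (p q : PosElem B) :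
    (p ⊓ q).map f = p.map f ⊓ q.map f :=
  toFun_injective <| by
    ext χ
    simp only [toFun_map, toFun_inf]

theorem dominated_of_map {B' : Type v} [CommCStarAlgebra B'] {f : B →⋆ₐ[ℂ] B'}
    (hf : Function.Injective f) {p q : PosElem B} (h : Dominated (p.map f) (q.map f)) :
    Dominated p q := by
  rw [dominated_iff] at *
  obtain ⟨n, hn⟩ := h
  refine ⟨n, fun χ => ?_⟩
  have h : 0 ≤ (n : ℝ) • q.toFun - p.toFun := nonneg_of_comp_nonneg hf fun χ => by
    have h := hn χ
    rw [toFun_map, toFun_map] at h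
    exact sub_nonneg.2 h
  exact sub_nonneg.1 (h χ)

theorem dominated_of_le {p q : PosElem B} (h : p ≤ q) : Dominated p q :=
  dominated_iff.2 ⟨1, fun χ => by simpa using le_iff_toFun_le.1 h χ⟩

/-- Two multiples of a nonnegative function are bounded by the larger one. Together with
`Dominated.le_inf` this makes suprema and infima in `C⁺` descend to the quotient. -/
theorem Dominated.sup_le {p q r : PosElem B} (h : Dominated p r) (h' : Dominated q r) :
    Dominated (p ⊔ q) r := by
  rw [dominated_iff] at *
  obtain ⟨n, hn⟩ := h
  obtain ⟨m, hm⟩ := h'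
  refine ⟨max n m, fun χ => ?_⟩
  have h0 : 0 ≤ r.toFun χ := r.toFun_nonneg χ
  rw [toFun_sup]
  refine max_le ((hn χ).trans ?_) ((hm χ).trans ?_) <;> gcongr
  exacts [le_max_left _ _, le_max_right _ _]

theorem Dominated.le_inf {p q r : PosElem B} (h : Dominated r p) (h' : Dominated r q) :
    Dominated r (p ⊓ q) := by
  rw [dominated_iff] at *
  obtain ⟨n, hn⟩ := h
  obtain ⟨m, hm⟩ := h'
  refine ⟨max n m, fun χ => ?_⟩
  have hp : 0 ≤ p.toFun χ := p.toFun_nonneg χ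
  have hq : 0 ≤ q.toFun χ := q.toFun_nonneg χ
  rw [toFun_inf, mul_min_of_nonneg _ _ (Nat.cast_nonneg _)]
  refine _root_.le_inf ((hn χ).trans ?_) ((hm χ).trans ?_) <;> gcongr
  exacts [le_max_left _ _, le_max_right _ _]

end PosElem

/-! ### The bounded distributive lattice of positive elements modulo `≈`. -/

namespace PosQuot

open PosElem

variable {B : Type u} [CommCStarAlgebra B]

theorem mk_le_mk_of_le {p q : PosElem B} (h : p ≤ q) : mk p ≤ mk q := dominated_of_le h

noncomputable instance : Lattice (PosQuot B) where
  sup := Quotient.map₂ (· ⊔ ·) fun _ _ h _ _ h' =>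
    ⟨(h.1.trans (dominated_of_le le_sup_left)).sup_le (h'.1.trans (dominated_of_le le_sup_right)),
      (h.2.trans (dominated_of_le le_sup_left)).sup_le (h'.2.trans (dominated_of_le le_sup_right))⟩
  inf := Quotient.map₂ (· ⊓ ·) fun _ _ h _ _ h' =>
    ⟨((dominated_of_le inf_le_left).trans h.1).le_inf ((dominated_of_le inf_le_right).trans h'.1),
      ((dominated_of_le inf_le_left).trans h.2).le_inf ((dominated_of_le inf_le_right).trans h'.2)⟩
  le_sup_left := by rintro ⟨p⟩ ⟨q⟩; exact mk_le_mk_of_le le_sup_left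
  le_sup_right := by rintro ⟨p⟩ ⟨q⟩; exact mk_le_mk_of_le le_sup_right
  sup_le := by rintro ⟨p⟩ ⟨q⟩ ⟨r⟩ h h'; exact Dominated.sup_le h h'
  inf_le_left := by rintro ⟨p⟩ ⟨q⟩; exact mk_le_mk_of_le inf_le_left
  inf_le_right := by rintro ⟨p⟩ ⟨q⟩; exact mk_le_mk_of_le inf_le_right
  le_inf := by rintro ⟨r⟩ ⟨p⟩ ⟨q⟩ h h'; exact Dominated.le_inf h h'

theorem mk_sup (p q : PosElem B) : mk (p ⊔ q) = mk p ⊔ mk q := rfl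

theorem mk_inf (p q : PosElem B) : mk (p ⊓ q) = mk p ⊓ mk q := rfl

noncomputable instance : DistribLattice (PosQuot B) :=
  DistribLattice.ofInfSupLe (by
    rintro ⟨p⟩ ⟨q⟩ ⟨r⟩
    refine mk_le_mk_of_le (le_iff_toFun_le.2 fun χ => ?_)
    change (p ⊓ (q ⊔ r)).toFun χ ≤ (p ⊓ q ⊔ p ⊓ r).toFun χ
    simp only [toFun_inf, toFun_sup]
    exact (inf_sup_left _ _ _).le)

noncomputable instance : BoundedOrder (PosQuot B) where
  top := mk (ofFun 1 zero_le_one)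
  bot := mk (ofFun 0 le_rfl)
  le_top := by
    rintro ⟨p⟩
    refine dominated_iff.2 ?_
    -- The unit is an order unit: a positive element is bounded by its norm.
    obtain ⟨n, hn⟩ := exists_nat_ge ‖p.toFun‖
    refine ⟨n, fun χ => ?_⟩
    rw [toFun_ofFun, ContinuousMap.one_apply, mul_one]
    exact ((le_abs_self _).trans (p.toFun.norm_coe_le_norm χ)).trans hn
  bot_le := by
    rintro ⟨p⟩
    refine mk_le_mk_of_le (le_iff_toFun_le.2 ?_)
    rw [toFun_ofFun]
    exact p.toFun_nonneg

theorem mk_eq_top {p : PosElem B} (h : ∀ χ, p.toFun χ = 1) : mk p = ⊤ :=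
  top_le_iff.1 <| mk_le_mk_of_le <| le_iff_toFun_le.2 fun χ => by simp [h]

theorem mk_eq_bot {p : PosElem B} (h : ∀ χ, p.toFun χ = 0) : mk p = ⊥ :=
  le_bot_iff.1 <| mk_le_mk_of_le <| le_iff_toFun_le.2 fun χ => by simp [h]

variable {B' : Type v} [CommCStarAlgebra B']

/-- The lattice homomorphism `[p] ↦ [f p]`. -/
noncomputable def mapHom (f : B →⋆ₐ[ℂ] B') : BoundedLatticeHom (PosQuot B) (PosQuot B') where
  toFun := map f
  map_sup' := by rintro ⟨p⟩ ⟨q⟩; exact congrArg mk (PosElem.map_sup f p q)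
  map_inf' := by rintro ⟨p⟩ ⟨q⟩; exact congrArg mk (PosElem.map_inf f p q)
  map_top' := mk_eq_top fun χ => by rw [toFun_map, toFun_ofFun, ContinuousMap.one_apply]
  map_bot' := mk_eq_bot fun χ => by rw [toFun_map, toFun_ofFun, ContinuousMap.zero_apply]

theorem map_injective {f : B →⋆ₐ[ℂ] B'} (hf : Function.Injective f) :
    Function.Injective (map f) := by
  rintro ⟨p⟩ ⟨q⟩ h
  have h' := Quotient.exact h
  exact Quotient.sound ⟨dominated_of_map hf h'.1, dominated_of_map hf h'.2⟩

end PosQuot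

/-! ### The logarithmic gauge function. -/

namespace Real

/-- The function `t ↦ 1 / (1 - log t)` on `(0, 1]`, extended by constants to the real line. It turns
the preorder `∃ m n, s ^ m ≤ n * t` on bounded nonnegative functions into `∃ n, s ≤ n * t`. -/
noncomputable def logGauge (t : ℝ) : ℝ := if t ≤ 0 then 0 else (1 - log (min t 1))⁻¹

theorem logGauge_of_nonpos {t : ℝ} (h : t ≤ 0) : logGauge t = 0 := if_pos h

theorem logGauge_of_pos {t : ℝ} (h : 0 < t) : logGauge t = (1 - log (min t 1))⁻¹ :=
  if_neg h.not_ge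

theorem one_le_one_sub_log_min_one {t : ℝ} (h : 0 < t) : 1 ≤ 1 - log (min t 1) := by
  have := log_nonpos (lt_min h one_pos).le (min_le_right t 1)
  linarith

theorem logGauge_pos {t : ℝ} (h : 0 < t) : 0 < logGauge t := by
  rw [logGauge_of_pos h]
  exact inv_pos.2 (one_pos.trans_le (one_le_one_sub_log_min_one h))

theorem logGauge_nonneg (t : ℝ) : 0 ≤ logGauge t := by
  rcases le_or_gt t 0 with h | h
  · exact (logGauge_of_nonpos h).ge
  · exact (logGauge_pos h).le

theorem logGauge_of_one_le {t : ℝ} (h : 1 ≤ t) : logGauge t = 1 := by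
  rw [logGauge_of_pos (one_pos.trans_le h), min_eq_right h, log_one, sub_zero, inv_one]

theorem logGauge_mono : Monotone logGauge := by
  intro s t h
  rcases le_or_gt s 0 with hs | hs
  · exact (logGauge_of_nonpos hs).trans_le (logGauge_nonneg t)
  · have ht := hs.trans_le h
    rw [logGauge_of_pos hs, logGauge_of_pos ht]
    refine inv_anti₀ (one_pos.trans_le (one_le_one_sub_log_min_one ht)) ?_
    have := log_le_log (lt_min hs one_pos) (min_le_min_right 1 h)
    linarith

theorem logGauge_le_mul {s t : ℝ} (hs : 0 < s) (ht : 0 < t) {k : ℝ} :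
    logGauge s ≤ k * logGauge t ↔ 1 - log (min t 1) ≤ k * (1 - log (min s 1)) := by
  have h1 := one_pos.trans_le (one_le_one_sub_log_min_one hs)
  have h2 := one_pos.trans_le (one_le_one_sub_log_min_one ht)
  rw [logGauge_of_pos hs, logGauge_of_pos ht, ← div_eq_mul_inv, inv_eq_one_div,
    div_le_div_iff₀ h1 h2, one_mul]

/-- Doubling `t` shifts its logarithm by `log 2 ≤ 1`, which the summand `1` in the denominator
absorbs at the cost of a factor `2`. Scaling the argument thus does not change the gauge up to `≈`.
-/
theorem logGauge_two_mul_le (t : ℝ) : logGauge (2 * t) ≤ 2 * logGauge t := by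
  rcases le_or_gt t 0 with h | h
  · rw [logGauge_of_nonpos h, logGauge_of_nonpos (by linarith), mul_zero]
  · rw [logGauge_le_mul (by positivity) h]
    have h2 : log 2 ≤ 1 := by linarith [log_two_lt_d9]
    rcases le_total (2 * t) 1 with h1 | h1
    · have h3 := log_nonpos (by positivity) h1
      rw [min_eq_left h1, min_eq_left (by linarith)]
      rw [log_mul two_ne_zero h.ne'] at h3 ⊢
      linarith
    · rw [min_eq_right h1, log_one]
      have h3 : -log 2 ≤ log (min t 1) := by
        rw [← log_inv]
        exact log_le_log (by norm_num) (le_min (by linarith) (by norm_num))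
      linarith

theorem logGauge_two_pow_mul_le (n : ℕ) (t : ℝ) : logGauge (2 ^ n * t) ≤ 2 ^ n * logGauge t := by
  induction n with
  | zero => simp
  | succ n ih =>
    calc logGauge (2 ^ (n + 1) * t) = logGauge (2 * (2 ^ n * t)) := by ring_nf
      _ ≤ 2 * logGauge (2 ^ n * t) := logGauge_two_mul_le _
      _ ≤ 2 * (2 ^ n * logGauge t) := by gcongr
      _ = 2 ^ (n + 1) * logGauge t := by ring

/-- Squaring doubles the logarithm, so it at most halves the gauge; this is what makes the product
relation hold up to `≈`. -/
theorem logGauge_le_two_mul_mul_self {t : ℝ} (h : 0 < t) :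
    logGauge t ≤ 2 * logGauge (t * t) := by
  rw [logGauge_le_mul h (by positivity)]
  rcases le_total t 1 with h1 | h1
  · rw [min_eq_left h1, min_eq_left (by nlinarith), log_mul h.ne' h.ne']
    linarith
  · rw [min_eq_right h1, min_eq_right (by nlinarith), log_one]
    norm_num

theorem logGauge_add_le (s t : ℝ) :
    logGauge (s + t) ≤ 2 * max (logGauge s) (logGauge t) := by
  rw [← logGauge_mono.map_max]
  refine le_trans (logGauge_mono ?_) (logGauge_two_mul_le _)
  linarith [le_max_left s t, le_max_right s t]

theorem min_logGauge_le (s t : ℝ) :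
    min (logGauge s) (logGauge t) ≤ 2 * logGauge (s * t) := by
  rw [← logGauge_mono.map_min]
  rcases le_or_gt (min s t) 0 with h | h
  · rw [logGauge_of_nonpos h]
    exact mul_nonneg zero_le_two (logGauge_nonneg _)
  · refine (logGauge_le_two_mul_mul_self h).trans ?_
    gcongr
    refine logGauge_mono ?_
    have := lt_min_iff.1 h
    exact mul_le_mul (min_le_left _ _) (min_le_right _ _) h.le this.1.le

theorem logGauge_mul_le_of_pos {s t : ℝ} (hs : 0 < s) (ht : 0 < t) {n : ℕ} (hsn : s ≤ 2 ^ n)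
    (htn : t ≤ 2 ^ n) : logGauge (s * t) ≤ 2 ^ n * min (logGauge s) (logGauge t) := by
  rw [← logGauge_mono.map_min]
  refine le_trans (logGauge_mono ?_) (logGauge_two_pow_mul_le n _)
  rcases le_total s t with h | h
  · rw [min_eq_left h, mul_comm]
    gcongr
  · rw [min_eq_right h]
    gcongr

theorem logGauge_mul_le {s t : ℝ} {n : ℕ} (hs : |s| ≤ 2 ^ n) (ht : |t| ≤ 2 ^ n) :
    logGauge (s * t) ≤ 2 ^ n * max (min (logGauge s) (logGauge t))
      (min (logGauge (-s)) (logGauge (-t))) := by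
  rcases le_or_gt (s * t) 0 with h | h
  · rw [logGauge_of_nonpos h]
    have := logGauge_nonneg s
    have := logGauge_nonneg t
    positivity
  · rcases mul_pos_iff.1 h with ⟨h1, h2⟩ | ⟨h1, h2⟩
    · refine (logGauge_mul_le_of_pos h1 h2 ((le_abs_self _).trans hs)
        ((le_abs_self _).trans ht)).trans ?_
      gcongr
      exact le_max_left _ _
    · rw [← neg_mul_neg]
      refine (logGauge_mul_le_of_pos (neg_pos.2 h1) (neg_pos.2 h2) ((neg_le_abs _).trans hs)
        ((neg_le_abs _).trans ht)).trans ?_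
      gcongr
      exact le_max_right _ _

theorem max_min_logGauge_le (s t : ℝ) :
    max (min (logGauge s) (logGauge t)) (min (logGauge (-s)) (logGauge (-t))) ≤
      2 * logGauge (s * t) :=
  max_le (min_logGauge_le s t) (by simpa using min_logGauge_le (-s) (-t))

theorem logGauge_exp_mul_expNegInvGlue {s : ℝ} (h0 : 0 ≤ s) (h1 : s ≤ 1) :
    logGauge (exp 1 * expNegInvGlue s) = s := by
  rcases h0.eq_or_lt with rfl | h
  · simp [logGauge_of_nonpos]
  · have e : exp 1 * expNegInvGlue s = exp (1 - s⁻¹) := by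
      rw [expNegInvGlue, if_neg h.not_ge, ← exp_add, sub_eq_add_neg]
    have h2 : 1 - s⁻¹ ≤ 0 := sub_nonpos.2 ((one_le_inv₀ h).2 h1)
    rw [e, logGauge_of_pos (exp_pos _), min_eq_left (exp_le_one_iff.2 h2), log_exp,
      sub_sub_cancel, inv_inv]

theorem continuous_logGauge : Continuous logGauge := by
  rw [continuous_iff_continuousAt]
  intro t
  rcases lt_trichotomy t 0 with h | rfl | h
  · refine (continuousAt_const (y := (0 : ℝ))).congr ?_
    filter_upwards [Iio_mem_nhds h] with x hx using (logGauge_of_nonpos (le_of_lt hx)).symm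
  · rw [Metric.continuousAt_iff]
    intro ε hε
    -- The radius is the preimage of `min (ε / 2) 1` under the gauge; the truncation at `1` keeps it
    -- where the inverse formula is valid.
    have he : 0 < min (ε / 2) 1 := by positivity
    refine ⟨exp 1 * expNegInvGlue (min (ε / 2) 1),
      mul_pos (exp_pos 1) (expNegInvGlue.pos_of_pos he), fun {x} hx => ?_⟩
    rw [dist_zero_right] at hx
    rw [logGauge_of_nonpos le_rfl, dist_zero_right, norm_of_nonneg (logGauge_nonneg x)]
    calc logGauge x ≤ _ := logGauge_mono ((le_abs_self x).trans hx.le)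
      _ = min (ε / 2) 1 := logGauge_exp_mul_expNegInvGlue he.le (min_le_right _ _)
      _ < ε := (min_le_left _ _).trans_lt (half_lt_self hε)
  · have hc : ContinuousAt (fun x => (1 - log (min x 1))⁻¹) t :=
      ContinuousAt.inv₀ (f := fun x => 1 - log (min x 1))
        (continuousAt_const.sub (ContinuousAt.log (by fun_prop) (lt_min h one_pos).ne'))
        (one_pos.trans_le (one_le_one_sub_log_min_one h)).ne'
    refine hc.congr ?_
    filter_upwards [Ioi_mem_nhds h] with x hx using (logGauge_of_pos hx).symm

/-- For positive `s` and `t` the hypothesis is linear in logarithms, and exponentiating it bounds a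
power by a multiple. The exponent `k + 1` instead of `k` costs nothing since `min s 1 ≤ 1`, and it
keeps the case `s = 0`, `k = 0` true. -/
theorem min_one_pow_le_of_logGauge_le {s t : ℝ} (hs : 0 ≤ s) (ht : 0 ≤ t) {k : ℕ}
    (h : logGauge s ≤ k * logGauge t) : min s 1 ^ (k + 1) ≤ exp k * t := by
  rcases hs.eq_or_lt with rfl | hs
  · rw [min_eq_left zero_le_one, zero_pow k.succ_ne_zero]
    positivity
  · have ht : 0 < t := by
      by_contra! ht0
      rw [logGauge_of_nonpos ht0, mul_zero] at h
      exact (logGauge_pos hs).not_ge h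
    have hm := lt_min hs one_pos
    rw [logGauge_le_mul hs ht] at h
    have h1 := log_nonpos hm.le (min_le_right s 1)
    calc min s 1 ^ (k + 1) = exp ((k + 1) * log (min s 1)) := by
          rw [← log_rpow hm, exp_log (rpow_pos_of_pos hm _)]
          exact_mod_cast (rpow_natCast _ _).symm
      _ ≤ exp (k + log (min t 1)) := exp_le_exp.2 (by linarith)
      _ = exp k * min t 1 := by rw [exp_add, exp_log (lt_min ht one_pos)]
      _ ≤ exp k * t := by gcongr; exact min_le_left _ _

end Real

/-! ### The isomorphism of `L_C` with `C⁺/≈` and its naturality. -/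

namespace SpectralLattice

open WeakDual selfAdjoint PosElem Real

variable {B : Type u} [CommCStarAlgebra B]

/-- The positive element `f(a)`, where `f` is `Real.logGauge`. -/
noncomputable def gauge (a : selfAdjoint B) : PosElem B :=
  ofFun ⟨fun χ => logGauge (gelfandEquiv B a χ), continuous_logGauge.comp (by fun_prop)⟩
    fun χ => logGauge_nonneg (gelfandEquiv B a χ)

theorem toFun_gauge (a : selfAdjoint B) (χ : characterSpace ℂ B) :
    (gauge a).toFun χ = logGauge (gelfandEquiv B a χ) :=
  congrArg (· χ) (toFun_ofFun _ _)

theorem satisfies_mk_gauge : Satisfies fun a : selfAdjoint B => PosQuot.mk (gauge a) where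
  one := PosQuot.mk_eq_top fun χ => by
    rw [toFun_gauge, map_one]
    exact logGauge_of_one_le le_rfl
  inf_neg a := by
    rw [← PosQuot.mk_inf]
    refine PosQuot.mk_eq_bot fun χ => ?_
    rw [toFun_inf, toFun_gauge, toFun_gauge, map_neg, ContinuousMap.neg_apply]
    rcases le_total (gelfandEquiv B a χ) 0 with h | h
    · rw [logGauge_of_nonpos h, min_eq_left (logGauge_nonneg _)]
    · rw [logGauge_of_nonpos (neg_nonpos.2 h), min_eq_right (logGauge_nonneg _)]
  neg_sq b := PosQuot.mk_eq_bot fun χ => by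
    rw [toFun_gauge, map_neg, map_mul]
    exact logGauge_of_nonpos (neg_nonpos.2 (mul_self_nonneg _))
  add a b := by
    rw [← PosQuot.mk_sup]
    refine dominated_iff.2 ⟨2, fun χ => ?_⟩
    rw [toFun_sup, toFun_gauge, toFun_gauge, toFun_gauge, map_add]
    exact logGauge_add_le _ _
  mul a b := by
    rw [← PosQuot.mk_inf, ← PosQuot.mk_inf, ← PosQuot.mk_sup]
    refine le_antisymm (dominated_iff.2 ?_) (dominated_iff.2 ⟨2, fun χ => ?_⟩)
    · obtain ⟨n, hn⟩ := pow_unbounded_of_one_lt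
        (max ‖gelfandEquiv B a‖ ‖gelfandEquiv B b‖) one_lt_two
      refine ⟨2 ^ n, fun χ => ?_⟩
      rw [toFun_sup, toFun_inf, toFun_inf]
      simp only [toFun_gauge, map_mul, map_neg, ContinuousMap.mul_apply, ContinuousMap.neg_apply,
        Nat.cast_pow, Nat.cast_ofNat]
      exact logGauge_mul_le
        (((gelfandEquiv B a).norm_coe_le_norm χ).trans ((le_max_left _ _).trans hn.le))
        (((gelfandEquiv B b).norm_coe_le_norm χ).trans ((le_max_right _ _).trans hn.le))
    · rw [toFun_sup, toFun_inf, toFun_inf]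
      simp only [toFun_gauge, map_mul, map_neg, ContinuousMap.mul_apply, ContinuousMap.neg_apply]
      exact max_min_logGauge_le _ _

variable (B) in
/-- The homomorphism `D_a ↦ [f(a)]`, where `f` is `Real.logGauge`. -/
noncomputable def toPosQuot : BoundedLatticeHom (SpectralLattice (selfAdjoint B)) (PosQuot B) :=
  lift _ satisfies_mk_gauge

/-- Domination of gauges gives `a ^ (k + 1) ≤ n b` with uniform `k` and `n`, and `D` ignores both
powers of squares and natural multiples on the right: `D a = D (a ^ (k + 1)) ≤ D (n • b) ≤ D b`. -/
theorem D_le_D_of_dominated {a b : selfAdjoint B} (ha : IsSquare a) (hb : IsSquare b)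
    (h : Dominated (gauge a) (gauge b)) : D a ≤ D b := by
  obtain ⟨k, hk⟩ := dominated_iff.1 h
  -- The factor `max ‖a‖ 1` undoes the truncation of the gauge at `1`, through `s ≤ N * min s 1`.
  obtain ⟨n, hn⟩ := exists_nat_ge ((max ‖gelfandEquiv B a‖ 1) ^ (k + 1) * exp k)
  rw [← D_pow_succ_of_isSquare ha k]
  refine (D_le_of_isSquare_sub (isSquare_sub_iff.2 fun χ => ?_)).trans (D_nsmul_le n b)
  have h0 : 0 ≤ gelfandEquiv B a χ := gelfandEquiv_nonneg_iff.2 ha χ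
  have h1 : 0 ≤ gelfandEquiv B b χ := gelfandEquiv_nonneg_iff.2 hb χ
  have h2 := hk χ
  rw [toFun_gauge, toFun_gauge] at h2
  have h3 := min_one_pow_le_of_logGauge_le h0 h1 h2
  rw [map_pow, map_nsmul]
  change gelfandEquiv B a χ ^ (k + 1) ≤ n • gelfandEquiv B b χ
  have hs := (le_abs_self _).trans ((gelfandEquiv B a).norm_coe_le_norm χ)
  generalize gelfandEquiv B a χ = s at *
  generalize gelfandEquiv B b χ = t at *
  set N := max ‖gelfandEquiv B a‖ 1
  have hN : s ≤ N * min s 1 := by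
    have h1N : 1 ≤ N := le_max_right _ _
    rcases le_total s 1 with h | h
    · rw [min_eq_left h]
      exact le_mul_of_one_le_left h0 h1N
    · rw [min_eq_right h, mul_one]
      exact hs.trans (le_max_left _ _)
  calc s ^ (k + 1) ≤ (N * min s 1) ^ (k + 1) := by gcongr
    _ = N ^ (k + 1) * min s 1 ^ (k + 1) := mul_pow _ _ _
    _ ≤ N ^ (k + 1) * (exp k * t) := by gcongr
    _ = N ^ (k + 1) * exp k * t := by ring
    _ ≤ n * t := by gcongr
    _ = n • t := (nsmul_eq_mul _ _).symm

theorem toPosQuot_le_toPosQuot_iff {x y : SpectralLattice (selfAdjoint B)} :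
    toPosQuot B x ≤ toPosQuot B y ↔ x ≤ y := by
  obtain ⟨a, ha, rfl⟩ := exists_isSquare_D_eq
    (fun _ _ => selfAdjoint.isSquare_add) exists_eq_sub_of_isSquare x
  obtain ⟨b, hb, rfl⟩ := exists_isSquare_D_eq
    (fun _ _ => selfAdjoint.isSquare_add) exists_eq_sub_of_isSquare y
  exact ⟨D_le_D_of_dominated ha hb, fun h => OrderHomClass.mono (toPosQuot B) h⟩

theorem toPosQuot_surjective : Function.Surjective (toPosQuot B) := by
  rintro ⟨p⟩
  obtain ⟨n, hn⟩ := exists_nat_ge (max ‖p.toFun‖ 1)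
  have hn0 : (0 : ℝ) < n := one_pos.trans_le ((le_max_right _ _).trans hn)
  -- Division by `n` moves `p` into `[0, 1]`, where `s ↦ e · exp(-1/s)` inverts the gauge. The gauge
  -- of `a` is therefore `p / n`, which is equivalent to `p`.
  let a : selfAdjoint B := (gelfandEquiv B).symm
    ⟨fun χ => exp 1 * expNegInvGlue (p.toFun χ / n),
      continuous_const.mul ((expNegInvGlue.contDiff (n := 0)).continuous.comp (by fun_prop))⟩
  have ha (χ) : n * (gauge a).toFun χ = p.toFun χ := by
    rw [toFun_gauge, RingEquiv.apply_symm_apply, ContinuousMap.coe_mk,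
      logGauge_exp_mul_expNegInvGlue, mul_div_cancel₀ _ hn0.ne']
    · exact div_nonneg (p.toFun_nonneg χ) hn0.le
    · exact (div_le_one hn0).2 (((le_abs_self _).trans (p.toFun.norm_coe_le_norm χ)).trans
        ((le_max_left _ _).trans hn))
  refine ⟨D a, le_antisymm (dominated_iff.2 ⟨1, fun χ => ?_⟩)
    (dominated_iff.2 ⟨n, fun χ => (ha χ).ge⟩)⟩
  rw [← ha χ, Nat.cast_one, one_mul]
  exact le_mul_of_one_le_left ((gauge a).toFun_nonneg χ) ((le_max_right _ _).trans hn)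

variable (B) in
/-- The lattice of the self-adjoint part of a commutative C⋆-algebra is isomorphic to the lattice of
positive elements modulo `≈`. -/
noncomputable def equivPosQuot : SpectralLattice (selfAdjoint B) ≃o PosQuot B :=
  RelIso.ofSurjective (OrderEmbedding.ofMapLEIff (toPosQuot B) fun _ _ => toPosQuot_le_toPosQuot_iff)
    toPosQuot_surjective

/-- The gauge applies one fixed function to the Gelfand transform, so it commutes with
homomorphisms; this is the source of the compatibility of the isomorphisms with inclusions. -/
theorem gauge_map {B' : Type v} [CommCStarAlgebra B'] (f : B →⋆ₐ[ℂ] B') (a : selfAdjoint B) :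
    gauge ⟨f a.1, a.2.map f⟩ = (gauge a).map f :=
  toFun_injective <| by
    ext χ
    rw [toFun_gauge, gelfandEquiv_map, toFun_map, toFun_gauge]

theorem equivPosQuot_map {A : Type u} [CStarAlgebra A] {C D : CommSubalg A} (h : C ≤ D)
    (x : SpectralLattice (selfAdjoint C.1)) :
    equivPosQuot D.1 (map (CommSubalg.inclSA h) x) =
      PosQuot.map (CommSubalg.incl h) (equivPosQuot C.1 x) := by
  have e : (toPosQuot D.1).comp (map (CommSubalg.inclSA h)) =
      (PosQuot.mapHom (CommSubalg.incl h)).comp (toPosQuot C.1) :=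
    hom_ext fun a => congrArg PosQuot.mk (gauge_map (CommSubalg.incl h) a)
  exact DFunLike.congr_fun e x

theorem map_inclSA_injective {A : Type u} [CStarAlgebra A] {C D : CommSubalg A} (h : C ≤ D) :
    Function.Injective (map (CommSubalg.inclSA h)) := by
  intro x y hxy
  have e := congrArg (equivPosQuot D.1) hxy
  rw [equivPosQuot_map, equivPosQuot_map] at e
  exact (equivPosQuot C.1).injective
    (PosQuot.map_injective (StarSubalgebra.inclusion_injective h) e)

end SpectralLattice

theorem theoremA4 (A : Type u) [CStarAlgebra A] :
    -- the functor `C ↦ L_C` is the internal lattice presented by the spectrum relations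
    (localLatticeStr A).IsSpectralLattice (localLatticeGen A) ∧
    -- any internal lattice with this presentation is, at each stage `C`, the lattice `L_C`
    (∀ (L : CommSubalg A ⥤ Type u) (hL : InternalDistribLattice L) (d : bohrificationSA A ⟶ L),
      hL.IsSpectralLattice d →
      ∃ φ : ∀ C : CommSubalg A, SpectralLattice (selfAdjoint C.1) ≃ L.obj C,
        (∀ C, φ C ⊤ = hL.topAt C) ∧
        (∀ C, φ C ⊥ = hL.botAt C) ∧
        (∀ C x y, φ C (x ⊓ y) = hL.infAt C (φ C x) (φ C y)) ∧
        (∀ C x y, φ C (x ⊔ y) = hL.supAt C (φ C x) (φ C y)) ∧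
        (∀ C (c : selfAdjoint C.1), φ C (SpectralLattice.D c) = d.app C c) ∧
        (∀ (C D : CommSubalg A) (h : C ≤ D) (x : SpectralLattice (selfAdjoint C.1)),
          L.map (homOfLE h) (φ C x) = φ D (SpectralLattice.map (CommSubalg.inclSA h) x)) ∧
        (∀ (C D : CommSubalg A) (h : C ≤ D) (c : selfAdjoint C.1),
          L.map (homOfLE h) (φ C (SpectralLattice.D c)) =
            φ D (SpectralLattice.D (CommSubalg.inclSA h c)))) ∧
    -- the transition maps are injective
    (∀ (C D : CommSubalg A) (h : C ≤ D),
      Function.Injective (SpectralLattice.map (CommSubalg.inclSA h))) ∧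
    -- the lattice operations of `C⁺` induce those of `C⁺/≈`
    (∀ (C : CommSubalg A) (p q : PosElem C.1), ∃ s i : PosElem C.1,
      IsLUB {p, q} s ∧ IsGLB {p, q} i ∧
      IsLUB {PosQuot.mk p, PosQuot.mk q} (PosQuot.mk s) ∧
      IsGLB {PosQuot.mk p, PosQuot.mk q} (PosQuot.mk i)) ∧
    -- `L_C ≅ C⁺/≈`, compatibly with the inclusions
    (∃ e : ∀ C : CommSubalg A, SpectralLattice (selfAdjoint C.1) ≃o PosQuot C.1,
      ∀ (C D : CommSubalg A) (h : C ≤ D) (x : SpectralLattice (selfAdjoint C.1)),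
        e D (SpectralLattice.map (CommSubalg.inclSA h) x) =
          PosQuot.map (CommSubalg.incl h) (e C x)) := by
  refine ⟨InternalDistribLattice.isSpectralLattice_localLattice A, fun L hL d hd => ?_,
    fun C D h => SpectralLattice.map_inclSA_injective h, fun C p q => ?_,
    fun C => SpectralLattice.equivPosQuot C.1, fun C D h x => SpectralLattice.equivPosQuot_map h x⟩
  -- All the stagewise claims are read off from a single isomorphism of internal lattices: its
  -- components are the bijections, and its naturality identifies the transition maps.
  · obtain ⟨i, hi, hid⟩ :=
      (InternalDistribLattice.isSpectralLattice_localLattice A).exists_iso hd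
    refine ⟨fun C => (i.app C).toEquiv, fun C => hi.map_topAt C, fun C => hi.map_botAt C,
      fun C => hi.map_infAt C, fun C => hi.map_supAt C,
      fun C c => InternalDistribLattice.app_eq hid C c, fun C D h x => ?_, fun C D h c => ?_⟩
    · exact (ConcreteCategory.congr_hom (i.hom.naturality (homOfLE h)) x).symm
    · exact (ConcreteCategory.congr_hom (i.hom.naturality (homOfLE h)) (SpectralLattice.D c)).symm
  · exact ⟨p ⊔ q, p ⊓ q, isLUB_pair, isGLB_pair,
      isLUB_pair (a := PosQuot.mk p) (b := PosQuot.mk q),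
      isGLB_pair (a := PosQuot.mk p) (b := PosQuot.mk q)⟩
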